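/- Let $L$ be a first-order language, let $T$ be a complete $L$-theory, and let $\mathbb{M}$ be a monster model of $T$, i.e. a model of $T$ which is $\kappa$-saturated and strongly $\kappa$-homogeneous for some cardinal $\kappa > |L| + \aleph_0$. If $T$ is NIP and has the SOP, then there is an $L(\mathbb{M})$-formula $\phi(x,y)$ with $|x| = |y| = 1$ which has the SOP. Here $L(\mathbb{M})$ is $L$ expanded by constants naming the elements of $\mathbb{M}$, and $|x|$ is the length of a tuple of variables $x$. A formula $\phi(x,y)$ ($x$, $y$ finite tuples of variables) has the strict order property (SOP) with respect to a complete theory if in some model $M$ of this theory there is a sequence of tuples $b_0, b_1, \ldots$ with $\phi(M,b_0) \subsetneq \phi(M,b_1) \subsetneq \cdots$; for an $L(\mathbb{M})$-formula the complete theory is that of $\mathbb{M}$ as an $L(\mathbb{M})$-structure. The theory $T$ has the SOP if some $L$-formula has the SOP with respect to $T$. The theory $T$ is NIP if there are no $L$-formula $\phi(x,y)$, model $M$ of $T$ and tuples $(a_i)_{i \in \mathbb{N}}$, $(b_S)_{S \subseteq \mathbb{N}}$ in $M$ such that $M \models \phi(a_i, b_S)$ if and only if $i \in S$. -/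

import Mathlib

open FirstOrder

universe u v w

namespace FirstOrder.Language

/-- The set `φ(M, b)`, for a partitioned formula `φ(x; y)` and a tuple `b` in a structure `M`. -/
def Formula.solutionSet {L : Language.{u, v}} {α β : Type} (φ : L.Formula (α ⊕ β))
    {M : Type w} [L.Structure M] (b : β → M) : Set (α → M) :=
  {a | φ.Realize (Sum.elim a b)}

/-- The partitioned formula `φ(x; y)` has the strict order property with respect to the
(complete) theory `T`: in some model `M` of `T` there is a sequence `b₀, b₁, …` with
`φ(M, b₀) ⊊ φ(M, b₁) ⊊ ⋯`. -/
def Formula.HasSOP {L : Language.{u, v}} {α β : Type} (φ : L.Formula (α ⊕ β))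
    (T : L.Theory) : Prop :=
  ∃ (M : Theory.ModelType.{u, v, max u v} T) (b : ℕ → β → M),
    ∀ i, φ.solutionSet (b i) ⊂ φ.solutionSet (b (i + 1))

/-- The partitioned formula `φ(x; y)` has the independence property with respect to the
(complete) theory `T`: in some model of `T` there are tuples `a i` (`i ∈ ℕ`) and `b S`
(`S ⊆ ℕ`) such that `φ(a i, b S)` holds if and only if `i ∈ S`. -/
def Formula.HasIP {L : Language.{u, v}} {α β : Type} (φ : L.Formula (α ⊕ β))
    (T : L.Theory) : Prop :=
  ∃ (M : Theory.ModelType.{u, v, max u v} T) (a : ℕ → α → M) (b : Set ℕ → β → M),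
    ∀ i S, φ.Realize (Sum.elim (a i) (b S)) ↔ i ∈ S

/-- A theory has the SOP if some `L`-formula `φ(x; y)`, with `x` and `y` finite tuples of
variables, has it. -/
def Theory.HasSOP {L : Language.{u, v}} (T : L.Theory) : Prop :=
  ∃ (m n : ℕ) (φ : L.Formula (Fin m ⊕ Fin n)), φ.HasSOP T

/-- A theory is NIP if no `L`-formula `φ(x; y)`, with `x` and `y` finite tuples of variables,
has the independence property. -/
def Theory.IsNIP {L : Language.{u, v}} (T : L.Theory) : Prop :=
  ∀ (m n : ℕ) (φ : L.Formula (Fin m ⊕ Fin n)), ¬ φ.HasIP T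

/-- `M` is `κ`-saturated: every complete 1-type over a set of fewer than `κ` parameters of `M`
is realized in `M`. -/
def IsSaturatedModel (L : Language.{u, v}) (M : Type w) [L.Structure M] [Nonempty M]
    (κ : Cardinal.{w}) : Prop :=
  ∀ A : Set M, Cardinal.mk A < κ →
    ∀ p : (L[[A]].completeTheory M).CompleteType (Fin 1),
      ∃ a : Fin 1 → M, (L[[A]].completeTheory M).typeOf a = p

/-- `M` is strongly `κ`-homogeneous: every partial elementary map from a subset of `M` with fewer
than `κ` elements to `M` extends to an automorphism of `M`. -/
def IsStronglyHomogeneous (L : Language.{u, v}) (M : Type w) [L.Structure M]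
    (κ : Cardinal.{w}) : Prop :=
  ∀ A : Set M, Cardinal.mk A < κ → ∀ f : A → M,
    (∀ φ : L.Formula A, φ.Realize (fun a : A => (a : M)) ↔ φ.Realize f) →
      ∃ σ : M ≃[L] M, ∀ a : A, σ a = f a

/-- `M` is a monster model (of its complete theory), "small" meaning "of cardinality `< κ`":
`κ` is uncountable and larger than the number of symbols of `L`, and `M` is `κ`-saturated and
strongly `κ`-homogeneous. -/
structure IsMonster (L : Language.{u, v}) (M : Type w) [L.Structure M] [Nonempty M]
    (κ : Cardinal.{w}) : Prop where
  aleph0_lt : Cardinal.aleph0 < κ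
  card_lt : Cardinal.lift.{w} L.card < Cardinal.lift.{max u v} κ
  saturated : L.IsSaturatedModel M κ
  stronglyHomogeneous : L.IsStronglyHomogeneous M κ

end FirstOrder.Language

/-!
Work in a model `N` of `T` witnessing the SOP. A strictly increasing chain of solution sets gives a
formula with the order property in `N`: for all `m` there are `a i`, `b j` (`i, j < m`) such that,
for `i ≠ j`, `φ(a i, b j)` holds if and only if `i < j`.

*Reduction to one variable* (`Formula.HasOrderProperty.relabel_or_exists`). Let `φ(x₁, x; y)` have
the order property and fix `k`. For indices `u₀ < ⋯ < u_k` and a place `p`, consider the formulas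
`P_j(x₁; y₀, …, y_{k-1})` saying that some `x` satisfies `φ(x₁, x; yᵢ) ↔ j ≤ i` for all `i`,
evaluated at the first part of `a (u_p)` and at the `b (u_i)` with `i ≠ p`. By Ramsey's theorem their
truth values may be assumed to depend on `p` and `j` only, and for `p = j` the value is "true", as the
second part of `a (u_p)` shows. If, for every `k`, the values for `p = 0` are all "true", then
`φ(x; x₁, y)` has the order property. Otherwise, for some `k`, there are `j` and `p` for which the
values at `p` and `p + 1` differ, which means that the truth value of `P_j` changes when a single
`b` moves past the removed index: up to a negation, `P_j` has the order property, and only `x₁` is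
left on its left hand side. By induction some formula `φ(x; y)` with the order property has `x`,
hence after exchanging the two sides `y`, of length one.

*Shelah's argument* (`Formula.HasOrderProperty.exists_chain`). For a homogeneous sequence `b` the
consistency of `⋀ φ(x; b (u_i))^{η i}` depends on `η` only. It holds for increasing `η`; by NIP
it fails for some `η` when `k` is large. So swapping some neighbouring entries `0, 1` of a
consistent `η` makes it inconsistent. Fixing the other `b (u_i)` as parameters `c` gives a formula
`ψ(x; y, c)` whose solution sets for `y` running through a window of `b` are strictly increasing.

*Conclusion*. The formula `∀ x, ψ(x; y, c) → ψ(x; y', c)` in the single variables `y` and `y'` is a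
quasi-order, with arbitrarily long strict chains for suitable `c` in `N`. Completeness of `T` moves
the chains to the monster model `M`, and saturation of `M` gives one `c` for all lengths. The
initial segments of the quasi-order are then the solution sets asked for, in an ultrapower of `M`
(`Formula.hasSOP_of_forall_exists_chain`).
-/

namespace FirstOrder.Language

/-! ### Finite Ramsey theory -/

/-- The finite Ramsey theorem for `k`-element sets, by induction on `k`: picking points one at a
time and thinning out the rest gives a long set on which the colour of a `(k + 1)`-set depends on
its least element only, and the pigeonhole principle does the rest. -/
theorem exists_monochromatic_finset (C : Type*) [Finite C] (k : ℕ) :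
    ∀ m : ℕ, ∃ N : ℕ, ∀ S : Finset ℕ, N ≤ S.card → ∀ f : Finset ℕ → C,
      ∃ H ⊆ S, m ≤ H.card ∧ ∃ c, ∀ s ⊆ H, s.card = k → f s = c := by
  classical
  induction k with
  | zero =>
    intro m
    refine ⟨m, fun S hS f => ⟨S, subset_rfl, hS, f ∅, fun s _ hs => ?_⟩⟩
    rw [Finset.card_eq_zero.1 hs]
  | succ k ih =>
    have key : ∀ r : ℕ, ∃ N : ℕ, ∀ S : Finset ℕ, N ≤ S.card → ∀ f : Finset ℕ → C,
        ∃ H ⊆ S, r ≤ H.card ∧ ∃ g : ℕ → C, ∀ s ⊆ H, s.card = k + 1 →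
          ∀ x ∈ s, (∀ y ∈ s, x ≤ y) → f s = g x := by
      intro r
      induction r with
      | zero =>
        refine ⟨0, fun S _ f => ⟨∅, by simp, by simp, fun _ => f ∅, fun s hs hk => ?_⟩⟩
        rw [Finset.subset_empty.1 hs] at hk
        simp at hk
      | succ r ihr =>
        obtain ⟨N₁, hN₁⟩ := ihr
        obtain ⟨N₂, hN₂⟩ := ih N₁
        refine ⟨N₂ + 1, fun S hS f => ?_⟩
        have hne : S.Nonempty := Finset.card_pos.1 (by omega)
        set x := S.min' hne with hx
        have hxS : x ∈ S := S.min'_mem hne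
        obtain ⟨H₁, hH₁, hc₁, c, hc⟩ := hN₂ (S.erase x)
          (by rw [Finset.card_erase_of_mem hxS]; omega) (fun s => f (insert x s))
        obtain ⟨H₂, hH₂, hc₂, g, hg⟩ := hN₁ H₁ hc₁ f
        have hx₂ : x ∉ H₂ := fun h => Finset.notMem_erase x S (hH₁ (hH₂ h))
        refine ⟨insert x H₂, ?_, ?_, Function.update g x c, fun s hs hk y hy hmin => ?_⟩
        · intro y hy
          rcases Finset.mem_insert.1 hy with rfl | hy
          · exact hxS
          · exact Finset.mem_of_mem_erase (hH₁ (hH₂ hy))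
        · rw [Finset.card_insert_of_notMem hx₂]; omega
        · by_cases hxs : x ∈ s
          · have hyx : y = x := by
              refine le_antisymm (hmin x hxs) (S.min'_le y ?_)
              rcases Finset.mem_insert.1 (hs hy) with h | h
              · rw [h]; exact hxS
              · exact Finset.mem_of_mem_erase (hH₁ (hH₂ h))
            rw [hyx, Function.update_self, ← Finset.insert_erase hxs]
            refine hc _ (fun z hz => hH₂ ?_) (by rw [Finset.card_erase_of_mem hxs]; omega)
            exact (Finset.mem_insert.1 (hs (Finset.mem_of_mem_erase hz))).resolve_left
              (Finset.ne_of_mem_erase hz)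
          · have hyx : y ≠ x := fun h => hxs (h ▸ hy)
            rw [Function.update_of_ne hyx]
            refine hg s (fun z hz => ?_) hk y hy hmin
            exact (Finset.mem_insert.1 (hs hz)).resolve_left fun h => hxs (h ▸ hz)
    intro m
    have := Fintype.ofFinite C
    obtain ⟨N, hN⟩ := key (Fintype.card C * m + 1)
    refine ⟨N, fun S hS f => ?_⟩
    obtain ⟨H, hHS, hH, g, hg⟩ := hN S hS f
    obtain ⟨c, -, hc⟩ := Finset.exists_lt_card_fiber_of_mul_lt_card_of_maps_to
      (s := H) (t := (Finset.univ : Finset C)) (f := g) (n := m) (fun _ _ => Finset.mem_univ _)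
      (by rw [Finset.card_univ]; omega)
    refine ⟨H.filter fun x => g x = c, (Finset.filter_subset _ _).trans hHS, hc.le, c,
      fun s hs hk => ?_⟩
    have hne : s.Nonempty := Finset.card_pos.1 (by omega)
    rw [hg s (hs.trans (Finset.filter_subset _ _)) hk (s.min' hne) (s.min'_mem hne)
      fun y hy => s.min'_le y hy]
    exact (Finset.mem_filter.1 (hs (s.min'_mem hne))).2

/-- The finite Ramsey theorem, for colourings of increasing `k`-tuples. -/
theorem exists_monochromatic_orderEmbedding (C : Type*) [Finite C] (k m : ℕ) :
    ∃ N : ℕ, ∀ f : (Fin k ↪o Fin N) → C, ∃ e : Fin m ↪o Fin N, ∀ g g' : Fin k ↪o Fin m,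
      f (g.trans e) = f (g'.trans e) := by
  classical
  obtain ⟨N, hN⟩ := exists_monochromatic_finset (Option C) k m
  refine ⟨N, fun f => ?_⟩
  -- an increasing tuple is determined by the set of its entries; other sets get a spare colour
  let img : (Fin k ↪o Fin N) → Finset ℕ := fun g => Finset.univ.image fun i => (g i : ℕ)
  have img_inj : ∀ g g', img g = img g' → g = g' := by
    intro g g' h
    have h1 : Set.range (fun i => (g i : ℕ)) = Set.range fun i => (g' i : ℕ) := by
      simpa [img] using congrArg (fun s : Finset ℕ => (s : Set ℕ)) h
    have hmono : ∀ g : Fin k ↪o Fin N, StrictMono fun i => (g i : ℕ) :=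
      fun g _ _ hij => g.strictMono hij
    have h2 := ((hmono g).range_inj (hmono g')).1 h1
    exact RelEmbedding.ext fun i => Fin.ext (congrFun h2 i)
  obtain ⟨H, hHN, hH, c, hc⟩ := hN (Finset.range N) (by simp)
    fun s => if h : ∃ g, img g = s then some (f h.choose) else none
  have hlt : ∀ i, H.orderEmbOfCardLe hH i < N := fun i =>
    Finset.mem_range.1 (hHN (Finset.orderEmbOfCardLe_mem H hH i))
  let e : Fin m ↪o Fin N := OrderEmbedding.ofStrictMono (fun i => ⟨H.orderEmbOfCardLe hH i, hlt i⟩)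
    fun i j hij => (H.orderEmbOfCardLe hH).strictMono hij
  have key : ∀ g : Fin k ↪o Fin m, some (f (g.trans e)) = c := by
    intro g
    have hex : ∃ g', img g' = img (g.trans e) := ⟨_, rfl⟩
    rw [← hc (img (g.trans e)) ?_ ?_, dif_pos hex, img_inj _ _ hex.choose_spec]
    · intro x hx
      obtain ⟨i, -, rfl⟩ := Finset.mem_image.1 hx
      exact Finset.orderEmbOfCardLe_mem H hH (g i)
    · rw [Finset.card_image_of_injective _ fun i j h => (g.trans e).injective (Fin.ext h)]
      simp
  exact ⟨e, fun g g' => Option.some_injective _ ((key g).trans (key g').symm)⟩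

/-! ### Combinatorics of finite sequences -/

/-- A pigeonhole principle: if at every stage one of finitely many decreasing properties holds,
then one of them holds at all stages. -/
theorem exists_forall_of_forall_exists {ι : Type*} [Finite ι] {Q : ι → ℕ → Prop}
    (hQ : ∀ i m n, m ≤ n → Q i n → Q i m) (h : ∀ n, ∃ i, Q i n) : ∃ i, ∀ n, Q i n := by
  by_contra! hcon
  choose g hg using hcon
  obtain ⟨B, hB⟩ := (Set.finite_range g).bddAbove
  obtain ⟨i, hi⟩ := h B
  exact hg i (hQ i _ _ (hB ⟨i, rfl⟩) hi)

/-- A property of `0`-`1`-sequences that holds for the increasing ones and is kept when two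
neighbouring entries `0, 1` are swapped holds for all sequences. -/
theorem forall_of_monotone_of_swap {k : ℕ} {D : (Fin k → Bool) → Prop}
    (hmono : ∀ η, Monotone η → D η)
    (hswap : ∀ (η : Fin k → Bool) (p q : Fin k), (p : ℕ) + 1 = q → η p = false → η q = true →
      D η → D (η ∘ Equiv.swap p q)) (η : Fin k → Bool) : D η := by
  -- undoing an inversion moves an entry `0` to the left
  induction hn : ∑ i : Fin k, (if η i then 0 else (i : ℕ)) using Nat.strong_induction_on
    generalizing η with
  | _ n ih =>
    by_cases hη : Monotone η
    · exact hmono η hη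
    obtain ⟨p, q, hpq, hp, hq⟩ : ∃ p q : Fin k, (p : ℕ) + 1 = q ∧ η p = true ∧ η q = false := by
      by_contra! hcon
      apply hη
      cases k with
      | zero => exact fun i => i.elim0
      | succ k =>
        rw [Fin.monotone_iff_le_succ]
        intro i
        by_cases h : η i.castSucc = true
        · have := hcon i.castSucc i.succ (by simp) h
          simp only [ne_eq, Bool.not_eq_false] at this
          rw [this]
          exact Bool.le_true _
        · rw [Bool.not_eq_true] at h
          rw [h]
          exact Bool.false_le _
    have hne : p ≠ q := fun h => by rw [h] at hpq; omega
    have := hswap (η ∘ Equiv.swap p q) p q hpq (by simp [hq]) (by simp [hp]) (ih _ ?_ _ rfl)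
    · simpa [Function.comp_assoc, ← Equiv.Perm.coe_mul] using this
    · rw [← hn, ← Finset.add_sum_erase _ _ (Finset.mem_univ p),
        ← Finset.add_sum_erase _ _ (Finset.mem_erase.2 ⟨hne.symm, Finset.mem_univ q⟩),
        ← Finset.add_sum_erase _ (fun i => if η i then 0 else (i : ℕ)) (Finset.mem_univ p),
        ← Finset.add_sum_erase _ (fun i => if η i then 0 else (i : ℕ))
          (Finset.mem_erase.2 ⟨hne.symm, Finset.mem_univ q⟩)]
      have hrest : ∑ i ∈ (Finset.univ.erase p).erase q,
          (if (η ∘ Equiv.swap p q) i then 0 else (i : ℕ)) =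
          ∑ i ∈ (Finset.univ.erase p).erase q, (if η i then 0 else (i : ℕ)) := by
        refine Finset.sum_congr rfl fun i hi => ?_
        rw [Finset.mem_erase, Finset.mem_erase] at hi
        rw [Function.comp_apply, Equiv.swap_apply_of_ne_of_ne hi.2.1 hi.1]
      rw [hrest]
      simp [hp, hq]
      omega

/-- The increasing `k`-tuple in `k + w` that has its entries number `p` and `p + 1` at the places
`i < j` of a window of length `w` starting at `p`, and its other entries outside this window,
at places depending neither on `i` nor on `j`. -/
def windowEmb (k w : ℕ) (p : ℕ) (i j : Fin w) (hij : i < j) : Fin k ↪o Fin (k + w) :=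
  OrderEmbedding.ofStrictMono
    (fun r => ⟨if (r : ℕ) < p then r else if (r : ℕ) = p then p + i else
      if (r : ℕ) = p + 1 then p + j else r + w, by split_ifs <;> omega⟩)
    (by
      intro r s hrs
      rw [Fin.lt_def] at hrs hij ⊢
      dsimp only
      split_ifs <;> omega)

theorem coe_windowEmb {k w p : ℕ} {i j : Fin w} (hij : i < j) (r : Fin k) :
    (windowEmb k w p i j hij r : ℕ) = if (r : ℕ) < p then (r : ℕ) else
      if (r : ℕ) = p then p + i else if (r : ℕ) = p + 1 then p + j else r + w :=
  rfl

section

variable {L : Language.{u, v}} {α α' β γ : Type} {M : Type w} [L.Structure M]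

/-! ### The order property in a structure -/

/-- The formula `φ(x; y)` has the order property in the structure `M`: for all `m` there are tuples
`a i` and `b i` (`i < m`) in `M` such that `φ(a i, b j)` holds if and only if `i < j`. Nothing is
asked for `i = j`, so that the notion is symmetric in `x` and `y` and under negation. -/
def Formula.HasOrderProperty (φ : L.Formula (α ⊕ β)) (M : Type w) [L.Structure M] : Prop :=
  ∀ m : ℕ, ∃ (a : Fin m → α → M) (b : Fin m → β → M),
    ∀ i j, i ≠ j → (φ.Realize (Sum.elim (a i) (b j)) ↔ i < j)

/-- `φ(x; y)` shatters some set of `k` tuples `b 0, …, b (k - 1)`, which are substituted for `y`. -/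
def Formula.Shatters (φ : L.Formula (α ⊕ β)) (M : Type w) [L.Structure M] (k : ℕ) : Prop :=
  ∃ b : Fin k → β → M, ∀ η : Fin k → Bool, ∃ x : α → M,
    ∀ i, φ.Realize (Sum.elim x (b i)) ↔ η i = true

theorem Formula.hasOrderProperty_of_solutionSet_ssubset {φ : L.Formula (α ⊕ β)} {b : ℕ → β → M}
    (hb : ∀ i, φ.solutionSet (b i) ⊂ φ.solutionSet (b (i + 1))) : φ.HasOrderProperty M := by
  have hmono : Monotone fun i => φ.solutionSet (b i) := monotone_nat_of_le_succ fun i => (hb i).le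
  choose a ha ha' using fun i => Set.exists_of_ssubset (hb i)
  refine fun m => ⟨fun i => a i, fun j => b j, fun i j _ => ⟨fun h => ?_, fun h => ?_⟩⟩
  · by_contra hij
    exact ha' i (hmono (not_lt.1 hij) h)
  · exact hmono (Nat.succ_le_of_lt h) (ha i)

theorem Formula.HasOrderProperty.relabel_equiv {φ : L.Formula (α ⊕ β)} (h : φ.HasOrderProperty M)
    (e : α ≃ α') (f : β ≃ γ) :
    Formula.HasOrderProperty (φ.relabel (Sum.map e f) : L.Formula (α' ⊕ γ)) M := by
  intro m
  obtain ⟨a, b, hab⟩ := h m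
  refine ⟨fun i => a i ∘ e.symm, fun j => b j ∘ f.symm, fun i j hij => ?_⟩
  rw [← hab i j hij, Formula.realize_relabel, Sum.elim_comp_map, Function.comp_assoc,
    Function.comp_assoc]
  simp

theorem Formula.HasOrderProperty.swap {φ : L.Formula (α ⊕ β)} (h : φ.HasOrderProperty M) :
    Formula.HasOrderProperty (φ.relabel Sum.swap : L.Formula (β ⊕ α)) M := by
  intro m
  obtain ⟨a, b, hab⟩ := h m
  refine ⟨fun i => b i.rev, fun j => a j.rev, fun i j hij => ?_⟩
  rw [Formula.realize_relabel, ← Fin.rev_lt_rev, ← hab j.rev i.rev (by simpa using hij.symm)]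
  refine iff_of_eq (congrArg _ ?_)
  ext (x | x) <;> rfl

/-- Order property sequences can be made homogeneous with respect to any finite colouring of their
finite subsequences. -/
theorem Formula.HasOrderProperty.exists_monochromatic {φ : L.Formula (α ⊕ β)}
    (h : φ.HasOrderProperty M) {C : Type*} [Finite C] (k m : ℕ)
    (F : (Fin k → (α → M)) → (Fin k → (β → M)) → C) :
    ∃ (a : Fin m → α → M) (b : Fin m → β → M),
      (∀ i j, i ≠ j → (φ.Realize (Sum.elim (a i) (b j)) ↔ i < j)) ∧
      ∀ g g' : Fin k ↪o Fin m, F (a ∘ g) (b ∘ g) = F (a ∘ g') (b ∘ g') := by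
  obtain ⟨N, hN⟩ := exists_monochromatic_orderEmbedding C k m
  obtain ⟨a, b, hab⟩ := h N
  obtain ⟨e, he⟩ := hN fun g => F (a ∘ g) (b ∘ g)
  refine ⟨a ∘ e, b ∘ e, fun i j hij => ?_, fun g g' => he g g'⟩
  rw [Function.comp_apply, Function.comp_apply, hab _ _ (e.injective.ne hij), e.lt_iff_lt]

/-! ### Reduction of the order property to one variable -/

/-- For `φ(x₁, x; y)`, the formula in `x₁` and `y₀, …, y_{k-1}` saying that for some `x` the truth
value of `φ(x₁, x; yᵢ)` is `η i`, for all `i`. -/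
noncomputable def Formula.pattern [Finite α'] {k : ℕ} (φ : L.Formula ((α ⊕ α') ⊕ β))
    (η : Fin k → Bool) : L.Formula (α ⊕ (Fin k × β)) :=
  Formula.iExs α' (Formula.iInf fun i : Fin k =>
    let φi : L.Formula ((α ⊕ (Fin k × β)) ⊕ α') := φ.relabel (Sum.elim
      (Sum.elim (fun x => Sum.inl (Sum.inl x)) Sum.inr) fun y => Sum.inl (Sum.inr (i, y)))
    if η i then φi else φi.not)

theorem Formula.realize_pattern [Finite α'] {k : ℕ} {φ : L.Formula ((α ⊕ α') ⊕ β)}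
    {η : Fin k → Bool} {a : α → M} {b : Fin k → β → M} :
    (φ.pattern η).Realize (Sum.elim a fun q => b q.1 q.2) ↔
      ∃ x : α' → M, ∀ i, φ.Realize (Sum.elim (Sum.elim a x) (b i)) ↔ η i = true := by
  rw [Formula.pattern, Formula.realize_iExs]
  refine exists_congr fun x => ?_
  rw [Formula.realize_iInf]
  refine forall_congr' fun i => ?_
  have : (Sum.elim (Sum.elim a fun q : Fin k × β => b q.1 q.2) x) ∘ (Sum.elim
      (Sum.elim (fun x => Sum.inl (Sum.inl x)) Sum.inr) fun y => Sum.inl (Sum.inr (i, y))) =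
      Sum.elim (Sum.elim a x) (b i) := by
    ext ((z | z) | z) <;> rfl
  cases h : η i <;> simp [Formula.realize_relabel, this]

/-- The variables `x₁` of a formula `φ(x₁, x; y)` with the order property can be removed from the
left hand side, unless some formula `θ(x₁; z)` has the order property. -/
theorem Formula.HasOrderProperty.relabel_or_exists [Finite α'] {φ : L.Formula ((α ⊕ α') ⊕ β)}
    (h : φ.HasOrderProperty M) :
    Formula.HasOrderProperty (φ.relabel (Sum.elim (Sum.elim (fun x => Sum.inr (Sum.inl x)) Sum.inl)
      fun y => Sum.inr (Sum.inr y)) : L.Formula (α' ⊕ (α ⊕ β))) M ∨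
    ∃ (k : ℕ) (θ : L.Formula (α ⊕ (Fin k × β))), θ.HasOrderProperty M := by
  rw [or_iff_not_imp_left, Formula.HasOrderProperty, not_forall]
  rintro ⟨k, hk⟩
  let step : Fin (k + 1) → Fin k → Bool := fun j i => decide (j ≤ i.castSucc)
  suffices H : ∃ j : Fin (k + 1), ∀ w : ℕ, ∃ (a : Fin w → α → M) (b : Fin w → (Fin k × β) → M),
      ∀ i l, i ≠ l → ((φ.pattern (step j)).not.Realize (Sum.elim (a i) (b l)) ↔ i < l) by
    obtain ⟨j, hj⟩ := H
    exact ⟨k, _, hj⟩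
  refine exists_forall_of_forall_exists (fun j m n hmn => ?_) fun w => ?_
  · rintro ⟨a, b, hab⟩
    exact ⟨a ∘ Fin.castLE hmn, b ∘ Fin.castLE hmn, fun i l hil =>
      hab _ _ ((Fin.castLE_injective hmn).ne hil)⟩
  -- the colour of a `(k + 1)`-tuple: remove its entry number `p` and use it for `x₁`
  let F : (Fin (k + 1) → (α ⊕ α' → M)) → (Fin (k + 1) → (β → M)) →
      Fin (k + 1) → Fin (k + 1) → Prop := fun a b p j =>
    ∃ x : α' → M, ∀ i, φ.Realize (Sum.elim (Sum.elim (a p ∘ Sum.inl) x) (b (p.succAbove i))) ↔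
      step j i = true
  obtain ⟨a, b, hab, hF⟩ := h.exists_monochromatic (k + 1) (k + 1 + w) F
  obtain ⟨c, hc⟩ : ∃ c, ∀ g : Fin (k + 1) ↪o Fin (k + 1 + w), F (a ∘ g) (b ∘ g) = c :=
    ⟨_, fun g => hF g (Fin.castLEOrderEmb (by omega))⟩
  -- the removed entry itself cuts the remaining ones at its own place
  have hdiag : ∀ p, c p p := by
    intro p
    rw [← hc (Fin.castLEOrderEmb (by omega))]
    refine ⟨a (Fin.castLEOrderEmb (by omega) p) ∘ Sum.inr, fun i => ?_⟩
    rw [Function.comp_apply, Sum.elim_comp_inl_inr, Function.comp_apply, hab,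
      OrderEmbedding.lt_iff_lt, Fin.lt_succAbove_iff_le_castSucc, decide_eq_true_iff]
    exact (RelEmbedding.injective _).ne (Fin.succAbove_ne p i).symm
  obtain ⟨j, hj⟩ : ∃ j, ¬ c 0 j := by
    by_contra! hall
    apply hk
    let g : Fin (k + 1) ↪o Fin (k + 1 + w) := Fin.castLEOrderEmb (by omega)
    have hall' : ∀ j : Fin k, F (a ∘ g) (b ∘ g) 0 j.castSucc := fun j => by rw [hc]; exact hall _
    choose x hx using hall'
    refine ⟨x, fun i => Sum.elim (a (g 0) ∘ Sum.inl) (b (g (Fin.succAbove 0 i))),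
      fun i l hil => ?_⟩
    have h1 := hx i l
    rw [Formula.realize_relabel]
    have h2 : Sum.elim (x i) (Sum.elim (a (g 0) ∘ Sum.inl) (b (g (Fin.succAbove 0 l)))) ∘
        (Sum.elim (Sum.elim (fun x => Sum.inr (Sum.inl x)) Sum.inl) fun y => Sum.inr (Sum.inr y)) =
        Sum.elim (Sum.elim (a (g 0) ∘ Sum.inl) (x i)) (b (g (Fin.succAbove 0 l))) := by
      ext ((z | z) | z) <;> rfl
    rw [h2]
    refine h1.trans ?_
    rw [decide_eq_true_iff, Fin.castSucc_le_castSucc_iff]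
    exact ⟨fun h => lt_of_le_of_ne h hil, le_of_lt⟩
  obtain ⟨p, hp, hp'⟩ : ∃ p : Fin k, ¬ c p.castSucc j ∧ c p.succ j := by
    by_contra! hcon
    exact Fin.induction (motive := fun p => ¬ c p j) hj hcon j (hdiag j)
  -- an entry moving in the window from the right to the left of the removed one changes the colour
  let v : Fin w → Fin k → Fin (k + 1 + w) := fun l r =>
    ⟨if (r : ℕ) < p then r else if (r : ℕ) = p then p + l else r + 1 + w, by split_ifs <;> omega⟩
  refine ⟨j, fun i => a ⟨p + i, by omega⟩ ∘ Sum.inl, fun l q => b (v l q.1) q.2, fun i l hil => ?_⟩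
  rw [Formula.realize_not, Formula.realize_pattern (b := fun r => b (v l r))]
  rcases lt_or_gt_of_ne hil with hlt | hlt
  · refine iff_of_true ?_ hlt
    rw [← hc (windowEmb (k + 1) w p i l hlt)] at hp
    have h1 : windowEmb (k + 1) w p i l hlt p.castSucc = ⟨p + i, by omega⟩ :=
      Fin.ext (by simp [coe_windowEmb])
    have h2 : ∀ r, windowEmb (k + 1) w p i l hlt (p.castSucc.succAbove r) = v l r := by
      intro r
      refine Fin.ext ?_
      simp only [coe_windowEmb, v]
      rcases lt_or_ge r p with hr | hr
      · rw [Fin.succAbove_castSucc_of_lt _ _ hr, Fin.val_castSucc]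
        split_ifs <;> omega
      · rw [Fin.succAbove_castSucc_of_le _ _ hr, Fin.val_succ]
        split_ifs <;> omega
    simpa only [F, Function.comp_apply, h1, h2] using hp
  · refine iff_of_false ?_ hlt.asymm
    rw [not_not]
    rw [← hc (windowEmb (k + 1) w p l i hlt)] at hp'
    have h1 : windowEmb (k + 1) w p l i hlt p.succ = ⟨p + i, by omega⟩ :=
      Fin.ext (by simp [coe_windowEmb])
    have h2 : ∀ r, windowEmb (k + 1) w p l i hlt (p.succ.succAbove r) = v l r := by
      intro r
      refine Fin.ext ?_
      simp only [coe_windowEmb, v]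
      rcases lt_or_ge p r with hr | hr
      · rw [Fin.succAbove_succ_of_lt _ _ hr, Fin.val_succ]
        split_ifs <;> omega
      · rw [Fin.succAbove_succ_of_le _ _ hr, Fin.val_castSucc]
        split_ifs <;> omega
    simpa only [F, Function.comp_apply, h1, h2] using hp'

/-- If some formula has the order property in `M`, then so does one with a single variable on the
left hand side. -/
theorem Formula.HasOrderProperty.exists_fin_one (n : ℕ) :
    ∀ {β : Type} [Finite β] {φ : L.Formula (Fin n ⊕ β)}, φ.HasOrderProperty M →
      ∃ (γ : Type) (_ : Finite γ) (ψ : L.Formula (Fin 1 ⊕ γ)), ψ.HasOrderProperty M := by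
  induction n with
  | zero =>
    intro β _ φ h
    obtain ⟨a, b, hab⟩ := h 3
    have h1 := (hab 0 1 (by decide)).2 (by decide)
    rw [Subsingleton.elim (a 0) (a 2), hab 2 1 (by decide)] at h1
    exact absurd h1 (by decide)
  | succ n ih =>
    intro β _ φ h
    rcases (h.relabel_equiv (finSumFinEquiv.trans (finCongr (add_comm 1 n))).symm
      (_root_.Equiv.refl β)).relabel_or_exists with h | ⟨k, θ, h⟩
    · exact ih h
    · exact ⟨_, inferInstance, θ, h⟩

/-! ### Strictly increasing chains of definable sets -/

/-- For `ψ(x; y, z)`, there are values `c` of `z` and `d 0, …, d (w - 1)` of `y` in `M` for which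
the sets `ψ(M; d i, c)` are strictly increasing. -/
def Formula.HasChain (ψ : L.Formula (α ⊕ (β ⊕ γ))) (M : Type w) [L.Structure M] (w : ℕ) : Prop :=
  ∃ (c : γ → M) (d : Fin w → β → M), ∀ i j, i < j →
    ψ.solutionSet (Sum.elim (d i) c) ⊂ ψ.solutionSet (Sum.elim (d j) c)

/-- `φ(x; y)` together with the conditions that the truth value of `φ(x; z r)` is `η r` for all `r`
other than `p` and `q`. -/
noncomputable def Formula.cutOut {k : ℕ} (φ : L.Formula (α ⊕ β)) (η : Fin k → Bool)
    (p q : Fin k) : L.Formula (α ⊕ (β ⊕ (Fin k × β))) :=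
  (φ.relabel (Sum.map id Sum.inl)) ⊓ Formula.iInf fun r : Fin k =>
    if r = p ∨ r = q then ⊤ else
      if η r then φ.relabel (Sum.map id fun y => Sum.inr (r, y))
      else Formula.not (φ.relabel (Sum.map id fun y => Sum.inr (r, y)))

theorem Formula.realize_cutOut {k : ℕ} {φ : L.Formula (α ⊕ β)} {η : Fin k → Bool} {p q : Fin k}
    {x : α → M} {y : β → M} {z : Fin k → β → M} :
    (φ.cutOut η p q).Realize (Sum.elim x (Sum.elim y fun s => z s.1 s.2)) ↔
      φ.Realize (Sum.elim x y) ∧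
        ∀ r, r ≠ p → r ≠ q → (φ.Realize (Sum.elim x (z r)) ↔ η r = true) := by
  rw [Formula.cutOut, Formula.realize_inf, Formula.realize_relabel, Sum.elim_comp_map,
    Sum.elim_comp_inl, Function.comp_id, Formula.realize_iInf]
  refine and_congr_right fun _ => forall_congr' fun r => ?_
  have : Sum.elim x (Sum.elim y fun s : Fin k × β => z s.1 s.2) ∘
      Sum.map id (fun y => Sum.inr (r, y)) = Sum.elim x (z r) := by
    ext (t | t) <;> rfl
  by_cases h : r = p ∨ r = q
  · rw [if_pos h]
    have : r ≠ p → ¬ r ≠ q := fun h1 h2 => h.elim h1 h2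
    simp only [Formula.realize_top, true_iff]
    exact fun h1 h2 => absurd h2 (this h1)
  · rw [if_neg h]
    rw [not_or] at h
    cases hη : η r <;> simp [Formula.realize_relabel, this, h]

/-- A formula with the order property but without the independence property yields, with the help of
parameters, arbitrarily long strictly increasing chains of definable sets. -/
theorem Formula.HasOrderProperty.exists_chain {φ : L.Formula (α ⊕ β)} (h : φ.HasOrderProperty M)
    {k : ℕ} (hk : ¬ φ.Shatters M k) :
    ∃ ψ : L.Formula (α ⊕ (β ⊕ (Fin k × β))), ∀ w, ψ.HasChain M w := by
  suffices H : ∃ s : (Fin k → Bool) × Fin k × Fin k, ∀ w : ℕ,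
      (φ.cutOut s.1 s.2.1 s.2.2).HasChain M w by
    obtain ⟨s, hs⟩ := H
    exact ⟨_, hs⟩
  have hanti : ∀ (s : (Fin k → Bool) × Fin k × Fin k) (m n : ℕ), m ≤ n →
      (φ.cutOut s.1 s.2.1 s.2.2).HasChain M n →
      (φ.cutOut s.1 s.2.1 s.2.2).HasChain M m := by
    rintro s m n hmn ⟨c, d, hd⟩
    exact ⟨c, d ∘ Fin.castLE hmn, fun i j hij => hd _ _ hij⟩
  refine exists_forall_of_forall_exists hanti fun w₀ => ?_
  -- a longer window leaves room for elements between the members of a `k`-tuple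
  suffices H : ∀ w : ℕ, k + 1 ≤ w → ∃ s : (Fin k → Bool) × Fin k × Fin k,
      (φ.cutOut s.1 s.2.1 s.2.2).HasChain M w by
    obtain ⟨s, hs⟩ := H (w₀ + (k + 1)) (by omega)
    exact ⟨s, hanti s _ _ (by omega) hs⟩
  intro w hw
  let F : (Fin k → (α → M)) → (Fin k → (β → M)) → (Fin k → Bool) → Prop := fun _ b η =>
    ∃ x : α → M, ∀ i, φ.Realize (Sum.elim x (b i)) ↔ η i = true
  obtain ⟨a, b, hab, hF⟩ := h.exists_monochromatic k (k + w) F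
  obtain ⟨D, hD⟩ : ∃ D, ∀ g : Fin k ↪o Fin (k + w), F (a ∘ g) (b ∘ g) = D :=
    ⟨_, fun g => hF g (Fin.castLEOrderEmb (by omega))⟩
  -- since not all patterns are consistent while increasing ones are, some swap is not allowed
  obtain ⟨η, p, q, hpq, hp, hq, hη, hη'⟩ : ∃ (η : Fin k → Bool) (p q : Fin k), (p : ℕ) + 1 = q ∧
      η p = false ∧ η q = true ∧ D η ∧ ¬ D (η ∘ Equiv.swap p q) := by
    by_contra! hcon
    refine hk ⟨b ∘ Fin.castLEOrderEmb (by omega : k ≤ k + w), fun η => ?_⟩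
    have := forall_of_monotone_of_swap (D := D) (fun η hη => ?_) hcon η
    · rw [← hD (Fin.castLEOrderEmb (by omega))] at this
      exact this
    · let g : Fin k ↪o Fin (k + w) := OrderEmbedding.ofStrictMono
        (fun i => ⟨2 * i + 1, by omega⟩) fun i j hij => by
          rw [Fin.lt_def] at hij ⊢
          dsimp only
          omega
      have hg : ∀ i, (g i : ℕ) = 2 * i + 1 := fun i => rfl
      obtain ⟨t, ht, ht'⟩ : ∃ t ≤ k, ∀ i : Fin k, η i = true ↔ t ≤ i := by
        have hex : ∃ t : ℕ, ∀ i : Fin k, t ≤ (i : ℕ) → η i = true :=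
          ⟨k, fun i hi => by omega⟩
        refine ⟨Nat.find hex, Nat.find_min' hex fun i hi => by omega, fun i =>
          ⟨fun hi => Nat.find_min' hex fun j hj => ?_, Nat.find_spec hex i⟩⟩
        exact Bool.eq_true_of_true_le (hi ▸ hη (Fin.le_def.2 hj))
      rw [← hD g]
      refine ⟨a ⟨2 * t, by omega⟩, fun i => ?_⟩
      rw [Function.comp_apply, hab, ht', Fin.lt_def, hg]
      · dsimp only
        omega
      · rw [ne_eq, Fin.ext_iff, hg]
        dsimp only
        omega
  let o : Fin k → Fin (k + w) := fun r => ⟨if (r : ℕ) < p then r else r + w, by split_ifs <;> omega⟩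
  have hwin : ∀ (i j : Fin w) (hij : i < j) (r : Fin k), r ≠ p → r ≠ q →
      windowEmb k w p i j hij r = o r := by
    intro i j hij r hrp hrq
    rw [ne_eq, Fin.ext_iff] at hrp hrq
    refine Fin.ext ?_
    simp only [coe_windowEmb, o]
    split_ifs <;> omega
  have hwp : ∀ (i j : Fin w) (hij : i < j), windowEmb k w p i j hij p = ⟨p + i, by omega⟩ :=
    fun i j hij => Fin.ext (by simp [coe_windowEmb])
  have hwq : ∀ (i j : Fin w) (hij : i < j), windowEmb k w p i j hij q = ⟨p + j, by omega⟩ :=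
    fun i j hij => Fin.ext (by simp [coe_windowEmb, ← hpq])
  have hne : p ≠ q := fun h => by rw [h] at hpq; omega
  refine ⟨⟨η, p, q⟩, fun s => b (o s.1) s.2, fun i => b ⟨p + i, by omega⟩, fun i j hij => ?_⟩
  rw [Set.ssubset_iff_of_subset]
  · rw [← hD (windowEmb k w p i j hij)] at hη
    obtain ⟨x, hx⟩ := hη
    refine ⟨x, ?_, ?_⟩
    · refine (Formula.realize_cutOut (z := fun r => b (o r))).2 ⟨?_, fun r hrp hrq => ?_⟩
      · have h1 := (hx q).2 hq
        rw [Function.comp_apply, hwq] at h1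
        exact h1
      · rw [← hwin i j hij r hrp hrq]
        exact hx r
    · intro hmem
      have h1 := ((Formula.realize_cutOut (z := fun r => b (o r))).1 hmem).1
      have h2 := hx p
      rw [Function.comp_apply, hwp, hp] at h2
      exact Bool.false_ne_true (h2.1 h1)
  · intro x hx
    obtain ⟨h1, h2⟩ := (Formula.realize_cutOut (z := fun r => b (o r))).1 hx
    refine (Formula.realize_cutOut (z := fun r => b (o r))).2 ⟨?_, h2⟩
    by_contra h3
    rw [← hD (windowEmb k w p i j hij)] at hη'
    refine hη' ⟨x, fun r => ?_⟩
    by_cases hrp : r = p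
    · rw [hrp, Function.comp_apply, hwp, Function.comp_apply, Equiv.swap_apply_left]
      exact iff_of_true h1 hq
    by_cases hrq : r = q
    · rw [hrq, Function.comp_apply, hwq, Function.comp_apply, Equiv.swap_apply_right]
      refine iff_of_false h3 ?_
      rw [hp]
      exact Bool.false_ne_true
    · rw [Function.comp_apply, hwin i j hij r hrp hrq, Function.comp_apply,
        Equiv.swap_apply_of_ne_of_ne hrp hrq]
      exact h2 r hrp hrq

/-! ### Ultrapowers and saturation -/

/-- The ultrapower of `M` with respect to a nonprincipal ultrafilter on `ℕ`. It is used as a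
countably saturated elementary extension of `M` that lives in the same universe as `M`. -/
abbrev NatPower (M : Type w) : Type w :=
  ((Filter.hyperfilter ℕ : Ultrafilter ℕ) : Filter ℕ).Product fun _ : ℕ => M

/-- The class of a sequence of assignments of variables, as an assignment of variables in the
ultrapower. -/
noncomputable def NatPower.mk {δ : Type*} (x : ℕ → δ → M) : δ → NatPower M :=
  fun i => ((fun n => x n i : ℕ → M) : NatPower M)

theorem NatPower.exists_eq_mk {δ : Type*} (y : δ → NatPower M) :
    ∃ x : ℕ → δ → M, NatPower.mk x = y := by
  choose x hx using fun i => Quotient.exists_rep (y i)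
  exact ⟨fun n i => x i n, funext hx⟩

theorem NatPower.mk_sumElim {δ ε : Type*} (x : ℕ → δ → M) (y : ℕ → ε → M) :
    Sum.elim (NatPower.mk x) (NatPower.mk y) = NatPower.mk fun n => Sum.elim (x n) (y n) := by
  ext (i | i) <;> rfl

variable [Nonempty M]

theorem NatPower.realize_mk {δ : Type*} (φ : L.Formula δ) (x : ℕ → δ → M) :
    φ.Realize (NatPower.mk x) ↔ ∀ᶠ n in (Filter.hyperfilter ℕ : Filter ℕ), φ.Realize (x n) :=
  Ultraproduct.realize_formula_cast φ fun i n => x n i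

theorem NatPower.model (T : L.Theory) [M ⊨ T] : NatPower M ⊨ T :=
  Theory.model_iff T |>.2 fun φ hφ =>
    Ultraproduct.sentence_realize φ |>.2 (.of_forall fun _ => T.realize_sentence_of_mem hφ)

theorem eventually_hyperfilter_of_le {p : ℕ → Prop} (n : ℕ) (h : ∀ m, n ≤ m → p m) :
    ∀ᶠ m in (Filter.hyperfilter ℕ : Filter ℕ), p m :=
  Nat.hyperfilter_le_atTop (Filter.eventually_atTop.2 ⟨n, h⟩)

/-- In a saturated model, countably many formulas in one variable over finitely many parameters
are satisfied simultaneously as soon as any finitely many of them are. -/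
theorem IsSaturatedModel.exists_forall_realize_fin_one {κ : Cardinal.{w}}
    (hM : L.IsSaturatedModel M κ) (hκ : Cardinal.aleph0 ≤ κ) [Finite γ] (v : γ → M)
    (θ : ℕ → L.Formula (γ ⊕ Fin 1))
    (h : ∀ n, ∃ z : Fin 1 → M, ∀ m ≤ n, (θ m).Realize (Sum.elim v z)) :
    ∃ z : Fin 1 → M, ∀ n, (θ n).Realize (Sum.elim v z) := by
  let A : Set M := Set.range v
  let θ' : ℕ → L[[A]].Formula (Fin 1) := fun n =>
    BoundedFormula.constantsVarsEquiv.symm ((θ n).relabel (Sum.map (Set.rangeFactorization v) id))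
  have hθ' : ∀ n (z : Fin 1 → M), (θ' n).Realize z ↔ (θ n).Realize (Sum.elim v z) := by
    intro n z
    rw [Formula.Realize, ← BoundedFormula.realize_constantsVarsEquiv, _root_.Equiv.apply_symm_apply]
    refine (Formula.realize_relabel (v := Sum.elim (fun a : A => (L.con a : M)) z)).trans ?_
    rw [Sum.elim_comp_map]
    refine iff_of_eq (congrArg _ ?_)
    ext (i | i)
    · simp [Set.rangeFactorization]
    · rfl
  choose z hz using h
  -- the structure of `M` for the language with parameters is what is to be passed to the ultrapower
  let : L[[A]].Structure (NatPower M) := Ultraproduct.structure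
  have := NatPower.model (L := L[[A]]) (M := M) (L[[A]].completeTheory M)
  obtain ⟨a, ha⟩ := hM A ((Set.finite_range v).lt_aleph0.trans_le hκ)
    ((L[[A]].completeTheory M).typeOf (NatPower.mk z))
  refine ⟨a, fun n => ?_⟩
  rw [← hθ', ← Theory.CompleteType.formula_mem_typeOf (T := L[[A]].completeTheory M), ha,
    Theory.CompleteType.formula_mem_typeOf, NatPower.realize_mk]
  exact eventually_hyperfilter_of_le n fun m hm => (hθ' n _).2 (hz m n hm)

theorem IsSaturatedModel.exists_forall_realize_fin {κ : Cardinal.{w}}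
    (hM : L.IsSaturatedModel M κ) (hκ : Cardinal.aleph0 ≤ κ) (k : ℕ) :
    ∀ {γ : Type} [Finite γ] (v : γ → M) (θ : ℕ → L.Formula (γ ⊕ Fin k)),
      (∀ n, ∃ z : Fin k → M, ∀ m ≤ n, (θ m).Realize (Sum.elim v z)) →
      ∃ z : Fin k → M, ∀ n, (θ n).Realize (Sum.elim v z) := by
  induction k with
  | zero =>
    intro γ _ v θ h
    refine ⟨default, fun n => ?_⟩
    obtain ⟨z, hz⟩ := h n
    rw [Subsingleton.elim default z]
    exact hz n le_rfl
  | succ k ih =>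
    intro γ _ v θ h
    let r : γ ⊕ Fin (k + 1) → (γ ⊕ Fin 1) ⊕ Fin k :=
      Sum.elim (fun i => Sum.inl (Sum.inl i)) (Fin.cases (Sum.inl (Sum.inr 0)) Sum.inr)
    have hr : ∀ (x : Fin 1 → M) (y : Fin k → M),
        Sum.elim (Sum.elim v x) y ∘ r = Sum.elim v (Fin.cons (x 0) y : Fin (k + 1) → M) := by
      intro x y
      ext (i | i)
      · rfl
      · cases i using Fin.cases <;> rfl
    obtain ⟨x, hx⟩ := hM.exists_forall_realize_fin_one hκ v
      (fun n => Formula.iExs (Fin k) (Formula.iInf fun m : Fin (n + 1) => (θ m).relabel r))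
      (fun n => by
        obtain ⟨z, hz⟩ := h n
        refine ⟨fun _ => z 0, fun m hm => ?_⟩
        rw [Formula.realize_iExs]
        refine ⟨Fin.tail z, ?_⟩
        rw [Formula.realize_iInf]
        intro i
        rw [Formula.realize_relabel, hr, Fin.cons_self_tail]
        exact hz i (by omega))
    obtain ⟨y, hy⟩ := ih (Sum.elim v x) (fun n => (θ n).relabel r) (fun n => by
      obtain ⟨y, hy⟩ := Formula.realize_iExs.1 (hx n)
      rw [Formula.realize_iInf] at hy
      exact ⟨y, fun m hm => hy ⟨m, by omega⟩⟩)
    refine ⟨Fin.cons (x 0) y, fun n => ?_⟩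
    rw [← hr, ← Formula.realize_relabel]
    exact hy n

/-- In a saturated model, countably many formulas in finitely many variables are satisfied
simultaneously as soon as any finitely many of them are. -/
theorem IsSaturatedModel.exists_forall_realize {κ : Cardinal.{w}}
    (hM : L.IsSaturatedModel M κ) (hκ : Cardinal.aleph0 ≤ κ) [Finite γ]
    (θ : ℕ → L.Formula γ) (h : ∀ n, ∃ z : γ → M, ∀ m ≤ n, (θ m).Realize z) :
    ∃ z : γ → M, ∀ n, (θ n).Realize z := by
  obtain ⟨k, ⟨e⟩⟩ := Finite.exists_equiv_fin γ
  have he : ∀ z : Fin k → M, Sum.elim (Empty.elim : Empty → M) z ∘ (fun i => Sum.inr (e i)) =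
      z ∘ e := fun z => rfl
  obtain ⟨z, hz⟩ := hM.exists_forall_realize_fin hκ k (Empty.elim : Empty → M)
    (fun n => (θ n).relabel fun i => Sum.inr (e i)) (fun n => by
      obtain ⟨z, hz⟩ := h n
      refine ⟨z ∘ e.symm, fun m hm => ?_⟩
      rw [Formula.realize_relabel, he, Function.comp_assoc, _root_.Equiv.symm_comp_self]
      exact hz m hm)
  refine ⟨z ∘ e, fun n => ?_⟩
  rw [← he, ← Formula.realize_relabel]
  exact hz n

/-! ### The properties SOP and NIP in terms of finite configurations -/

/-- Arbitrarily long finite chains of solution sets in `M` become an infinite chain in the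
ultrapower. -/
theorem NatPower.exists_solutionSet_ssubset {φ : L.Formula (α ⊕ β)}
    (h : ∀ w : ℕ, ∃ d : ℕ → β → M, ∀ i < w, φ.solutionSet (d i) ⊂ φ.solutionSet (d (i + 1))) :
    ∃ b : ℕ → β → NatPower M, ∀ i, φ.solutionSet (b i) ⊂ φ.solutionSet (b (i + 1)) := by
  choose d hd using h
  refine ⟨fun i => NatPower.mk fun n => d n i, fun i => ?_⟩
  rw [Set.ssubset_def]
  constructor
  · intro x hx
    obtain ⟨x, rfl⟩ := NatPower.exists_eq_mk x
    simp only [Formula.solutionSet, Set.mem_ofPred_eq, NatPower.mk_sumElim, NatPower.realize_mk]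
      at hx ⊢
    filter_upwards [hx, eventually_hyperfilter_of_le (i + 1) fun m hm => hd m i hm] with n h1 h2
    exact h2.1 h1
  · have : ∀ n, ∃ x : α → M, i < n →
        x ∈ φ.solutionSet (d n (i + 1)) ∧ x ∉ φ.solutionSet (d n i) := by
      intro n
      by_cases hn : i < n
      · obtain ⟨x, hx⟩ := Set.exists_of_ssubset (hd n i hn)
        exact ⟨x, fun _ => hx⟩
      · exact ⟨fun _ => Classical.arbitrary M, fun h => absurd h hn⟩
    choose x hx using this
    intro hsub
    have h1 : NatPower.mk x ∈ φ.solutionSet (NatPower.mk fun n => d n (i + 1)) := by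
      simp only [Formula.solutionSet, Set.mem_ofPred_eq, NatPower.mk_sumElim, NatPower.realize_mk]
      exact eventually_hyperfilter_of_le (i + 1) fun m hm => (hx m hm).1
    have h2 := hsub h1
    simp only [Formula.solutionSet, Set.mem_ofPred_eq, NatPower.mk_sumElim, NatPower.realize_mk]
      at h2
    obtain ⟨n, h3, h4⟩ := (h2.and (eventually_hyperfilter_of_le (i + 1)
      fun m hm => (hx m hm).2)).exists
    exact h4 h3

/-- In an NIP theory, every formula shatters finite sets of bounded size only. -/
theorem Theory.IsNIP.exists_not_shatters {T : L.Theory} (hT : T.IsNIP)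
    (N : Theory.ModelType.{u, v, max u v} T) [Finite α] [Finite β] (φ : L.Formula (α ⊕ β)) :
    ∃ k, ¬ φ.Shatters N k := by
  classical
  by_contra! hsh
  choose b x hx using hsh
  obtain ⟨m, ⟨e⟩⟩ := Finite.exists_equiv_fin α
  obtain ⟨n, ⟨f⟩⟩ := Finite.exists_equiv_fin β
  have := NatPower.model (M := N) T
  let r : α ⊕ β → Fin n ⊕ Fin m := Sum.elim (fun i => Sum.inr (e i)) fun i => Sum.inl (f i)
  let b' : ℕ → ℕ → Fin n → N := fun i k =>
    if h : i < k then b k ⟨i, h⟩ ∘ f.symm else fun _ => Classical.arbitrary N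
  let x' : Set ℕ → ℕ → Fin m → N := fun S k => x k (fun i => decide ((i : ℕ) ∈ S)) ∘ e.symm
  have key : ∀ i S k, i < k → ((φ.relabel r).Realize (Sum.elim (b' i k) (x' S k)) ↔ i ∈ S) := by
    intro i S k hk
    have h1 := hx k (fun i => decide ((i : ℕ) ∈ S)) ⟨i, hk⟩
    rw [decide_eq_true_iff] at h1
    rw [← h1, Formula.realize_relabel]
    refine iff_of_eq (congrArg _ ?_)
    ext (j | j) <;> simp [r, b', x', hk]
  have hreal : ∀ i S, (φ.relabel r).Realize
      (Sum.elim (NatPower.mk (b' i)) (NatPower.mk (x' S))) ↔ i ∈ S := by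
    intro i S
    rw [NatPower.mk_sumElim, NatPower.realize_mk]
    have hev := eventually_hyperfilter_of_le (i + 1) fun k hk => key i S k hk
    rw [Filter.eventually_congr hev, Filter.eventually_const]
  exact hT n m (φ.relabel r)
    ⟨Theory.ModelType.of T (NatPower N), fun i => NatPower.mk (b' i), fun S => NatPower.mk (x' S),
      hreal⟩

end

/-- A formula has the SOP with respect to a theory with model `M` if its solution sets in `M`
contain arbitrarily long strictly increasing chains. The symbols of the language may live in a
larger universe than `M`, as they do after naming the elements of `M`. -/
theorem Formula.hasSOP_of_forall_exists_chain {L : Language.{max u w, v}} {T : L.Theory}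
    {M : Type w} [L.Structure M] [Nonempty M] [M ⊨ T] {α β : Type} {φ : L.Formula (α ⊕ β)}
    (h : ∀ w : ℕ, ∃ d : ℕ → β → M, ∀ i < w, φ.solutionSet (d i) ⊂ φ.solutionSet (d (i + 1))) :
    φ.HasSOP T := by
  obtain ⟨b, hb⟩ := NatPower.exists_solutionSet_ssubset h
  have := NatPower.model (M := M) T
  let e : NatPower M ≃ ULift.{max u v} (NatPower M) := Equiv.ulift.symm
  let : L.Structure (ULift.{max u v} (NatPower M)) := e.inducedStructure
  let g : NatPower M ≃[L] ULift.{max u v} (NatPower M) := e.inducedStructureEquiv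
  have : ULift.{max u v} (NatPower M) ⊨ T := StrongHomClass.theory_model g
  have hg : ∀ (x : α → NatPower M) i,
      (g ∘ x) ∈ φ.solutionSet (g ∘ b i) ↔ x ∈ φ.solutionSet (b i) := by
    intro x i
    simp only [Formula.solutionSet, Set.mem_ofPred_eq]
    rw [← Sum.comp_elim, StrongHomClass.realize_formula]
  refine ⟨Theory.ModelType.of T (ULift.{max u v} (NatPower M)), fun i => g ∘ b i, fun i => ?_⟩
  rw [Set.ssubset_def]
  refine ⟨fun x hx => ?_, fun hsub => (hb i).2 fun x hx => ?_⟩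
  · have hx' : g ∘ (g.symm ∘ x) = x := funext fun j => g.apply_symm_apply (x j)
    rw [← hx'] at hx ⊢
    exact (hg _ _).2 ((hb i).1 ((hg _ _).1 hx))
  · exact (hg _ _).1 (hsub ((hg _ _).2 hx))

variable {L : Language.{u, v}} {α β γ : Type} {M : Type w} [L.Structure M]

/-! ### The definable quasi-order attached to a family of definable sets -/

/-- For `ψ(x; y, z)`, the formula saying of `z`, `y` and `y'` that every solution of `ψ(x; y, z)` is
a solution of `ψ(x; y', z)`. -/
noncomputable def Formula.inclusion [Finite α] (ψ : L.Formula (α ⊕ (β ⊕ γ))) :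
    L.Formula (γ ⊕ (β ⊕ β)) :=
  Formula.iAlls α (Formula.imp
    (ψ.relabel (Sum.elim Sum.inr (Sum.elim (fun y => Sum.inl (Sum.inr (Sum.inl y)))
      fun z => Sum.inl (Sum.inl z))))
    (ψ.relabel (Sum.elim Sum.inr (Sum.elim (fun y => Sum.inl (Sum.inr (Sum.inr y)))
      fun z => Sum.inl (Sum.inl z)))))

theorem Formula.realize_inclusion [Finite α] {ψ : L.Formula (α ⊕ (β ⊕ γ))} {z : γ → M}
    {y y' : β → M} :
    ψ.inclusion.Realize (Sum.elim z (Sum.elim y y')) ↔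
      ψ.solutionSet (Sum.elim y z) ⊆ ψ.solutionSet (Sum.elim y' z) := by
  rw [Formula.inclusion, Formula.realize_iAlls]
  refine forall_congr' fun x => ?_
  rw [Formula.realize_imp, Formula.realize_relabel, Formula.realize_relabel]
  change _ ↔ (ψ.Realize (Sum.elim x (Sum.elim y z)) → ψ.Realize (Sum.elim x (Sum.elim y' z)))
  refine imp_congr (iff_of_eq (congrArg _ ?_)) (iff_of_eq (congrArg _ ?_)) <;>
    ext (t | t | t) <;> rfl

/-- For `ψ(x; y, z)`, the formula saying of `z` that there are `w` values of `y` for which the sets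
defined by `ψ(x; y, z)` are strictly increasing. -/
noncomputable def Formula.chain [Finite α] [Finite β] (ψ : L.Formula (α ⊕ (β ⊕ γ))) (w : ℕ) :
    L.Formula γ :=
  Formula.iExs (Fin w × β) (Formula.iInf fun s : {s : Fin w × Fin w // s.1 < s.2} =>
    (ψ.inclusion.relabel (Sum.map id (Sum.elim (fun y => (s.1.1, y)) fun y => (s.1.2, y)))) ⊓
    Formula.not
      (ψ.inclusion.relabel (Sum.map id (Sum.elim (fun y => (s.1.2, y)) fun y => (s.1.1, y)))))

theorem Formula.realize_chain [Finite α] [Finite β] {ψ : L.Formula (α ⊕ (β ⊕ γ))} {w : ℕ}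
    {z : γ → M} :
    (ψ.chain w).Realize z ↔ ∃ d : Fin w → β → M, ∀ i j, i < j →
      ψ.solutionSet (Sum.elim (d i) z) ⊂ ψ.solutionSet (Sum.elim (d j) z) := by
  have key : ∀ (d : Fin w × β → M) (i j : Fin w),
      Formula.Realize (ψ.inclusion.relabel
        (Sum.map id (Sum.elim (fun y => (i, y)) fun y => (j, y))) : L.Formula (γ ⊕ (Fin w × β)))
        (Sum.elim z d) ↔ ψ.solutionSet (Sum.elim (fun y => d (i, y)) z) ⊆
          ψ.solutionSet (Sum.elim (fun y => d (j, y)) z) := by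
    intro d i j
    rw [Formula.realize_relabel, ← Formula.realize_inclusion]
    refine iff_of_eq (congrArg _ ?_)
    ext (t | t | t) <;> rfl
  rw [Formula.chain, Formula.realize_iExs, ← (Equiv.curry (Fin w) β M).exists_congr_right]
  refine exists_congr fun d => ?_
  rw [Formula.realize_iInf, Subtype.forall, Prod.forall]
  refine forall_congr' fun i => forall_congr' fun j => forall_congr' fun _ => ?_
  rw [Formula.realize_inf, Formula.realize_not, key, key]
  exact (Set.ssubset_def).symm.to_iff

end FirstOrder.Language

open FirstOrder.Language in
theorem mainTheorem2 {L : FirstOrder.Language.{u, v}} (T : L.Theory) (hT : T.IsComplete)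
    (M : Type w) [L.Structure M] [Nonempty M] [M ⊨ T]
    (κ : Cardinal.{w}) (hM : L.IsMonster M κ)
    (hNIP : T.IsNIP) (hSOP : T.HasSOP) :
    ∃ φ : L[[M]].Formula (Fin 1 ⊕ Fin 1), φ.HasSOP (L.elementaryDiagram M) := by
  obtain ⟨m, n, φ₀, N, b₀, hb₀⟩ := hSOP
  obtain ⟨γ₁, _, φ₁, h₁⟩ := (Formula.hasOrderProperty_of_solutionSet_ssubset hb₀).exists_fin_one
  obtain ⟨k, hk⟩ := hNIP.exists_not_shatters N (φ₁.relabel Sum.swap : L.Formula (γ₁ ⊕ Fin 1))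
  obtain ⟨ψ, hψ⟩ := h₁.swap.exists_chain hk
  -- the parameters of the chains can be found in `M`, and by saturation chosen once and for all
  have hchain : ∀ w : ℕ, ∃ c : Fin k × Fin 1 → M, (ψ.chain w).Realize c := by
    intro w
    let χ : L.Sentence := Formula.iExs (Fin k × Fin 1) ((ψ.chain w).relabel Sum.inr)
    have hN : N ⊨ χ := by
      obtain ⟨c, d, hd⟩ := hψ w
      refine Formula.realize_iExs.2 ⟨c, ?_⟩
      rw [Formula.realize_relabel, Sum.elim_comp_inr, Formula.realize_chain]
      exact ⟨d, hd⟩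
    have hMχ : M ⊨ χ := (hT.realize_sentence_iff χ M).2 ((hT.realize_sentence_iff χ N).1 hN)
    obtain ⟨c, hc⟩ := Formula.realize_iExs.1 hMχ
    rw [Formula.realize_relabel, Sum.elim_comp_inr] at hc
    exact ⟨c, hc⟩
  obtain ⟨c, hc⟩ := hM.saturated.exists_forall_realize hM.aleph0_lt.le ψ.chain (fun w => by
    obtain ⟨c, hc⟩ := hchain w
    refine ⟨c, fun w' hw => ?_⟩
    rw [Formula.realize_chain] at hc ⊢
    obtain ⟨d, hd⟩ := hc
    exact ⟨d ∘ Fin.castLE hw, fun i j hij => hd _ _ hij⟩)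
  let σ : L[[M]].Formula (Fin 1 ⊕ Fin 1) :=
    BoundedFormula.constantsVarsEquiv.symm (ψ.inclusion.relabel (Sum.map c id))
  have hσ : ∀ x y : Fin 1 → M, x ∈ σ.solutionSet y ↔
      ψ.solutionSet (Sum.elim x c) ⊆ ψ.solutionSet (Sum.elim y c) := by
    intro x y
    rw [← Formula.realize_inclusion]
    change σ.Realize _ ↔ _
    rw [Formula.Realize, ← BoundedFormula.realize_constantsVarsEquiv, _root_.Equiv.apply_symm_apply]
    refine (Formula.realize_relabel (v := Sum.elim (fun a : M => (L.con a : M)) _)).trans ?_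
    rw [Sum.elim_comp_map]
    refine iff_of_eq (congrArg _ ?_)
    ext (i | i)
    · rfl
    · rfl
  refine ⟨σ, Formula.hasSOP_of_forall_exists_chain (M := M) fun w => ?_⟩
  obtain ⟨d, hd⟩ := Formula.realize_chain.1 (hc (w + 1))
  refine ⟨fun i => d (Fin.ofNat (w + 1) i), fun i hi => ?_⟩
  have hlt : Fin.ofNat (w + 1) i < Fin.ofNat (w + 1) (i + 1) := by
    rw [Fin.lt_def, Fin.val_ofNat, Fin.val_ofNat, Nat.mod_eq_of_lt (by omega),
      Nat.mod_eq_of_lt (by omega)]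
    exact Nat.lt_succ_self i
  rw [Set.ssubset_iff_of_subset]
  · exact ⟨d (Fin.ofNat (w + 1) (i + 1)), (hσ _ _).2 subset_rfl,
      fun h => (hd _ _ hlt).2 ((hσ _ _).1 h)⟩
  · exact fun x hx => (hσ _ _).2 (((hσ _ _).1 hx).trans (hd _ _ hlt).1)
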